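/- **Theorem 5.1.** For a graph $G$ on the vertex set $V=\{1,\dots,n\}$, the cost of a partition $\mathcal C$ of $V$ is the number of unordered pairs of distinct vertices that are non-adjacent and in the same part of $\mathcal C$, plus the number of unordered pairs that are adjacent and in different parts. In the general graph model an algorithm knows $n$ and may adaptively ask, at unit cost each: degree queries (return $\deg(v)$), neighbor queries (return the $i$-th neighbor of $v$, or $\perp$ if $i>\deg(v)$), and pair queries (return whether $u,v$ are adjacent). The adjacency lists are ordered independently and uniformly at random. The worst-case query complexity of a randomized algorithm is the supremum of the number of queries that it makes, over all graphs on $V$, all orders of their adjacency lists, and all of its random choices. There is an absolute constant $c>0$ such that the following holds for every sequence $\varepsilon=\varepsilon(n)<10^{-6}$ with $\varepsilon=\omega\!\left(\frac{\log n}{n}\right)$, and for all sufficiently large $n$ (depending on the sequence only). Every randomized algorithm in the general graph model that, on every graph $G$ with $n$ vertices, outputs with probability at least $1/3$ (over its own randomness and the random order of the adjacency lists) a partition whose cost in $G$ is at most $\varepsilon n^2$ larger than the minimum cost over all partitions, has worst-case query complexity at least $c\,n/\varepsilon$. -/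

import Mathlib

open Filter
open scoped ENNReal

namespace CorrClust

/-- A clustering of the vertex set `Fin n`: a partition into any number of nonempty clusters. -/
abbrev Clustering (n : ℕ) : Type := Finpartition (Finset.univ : Finset (Fin n))

/-- `u` and `v` lie in the same cluster of `C`. -/
def Clustering.Same {n : ℕ} (C : Clustering n) (u v : Fin n) : Prop :=
  ∃ P ∈ C.parts, u ∈ P ∧ v ∈ P

open Classical in
/-- The correlation clustering cost: the number of unordered pairs of distinct vertices (counted as
`u < v`) that are non-edges inside a cluster, plus the number of those that are edges between
different clusters. -/
noncomputable def cost {n : ℕ} (G : SimpleGraph (Fin n)) (C : Clustering n) : ℕ :=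
  (Finset.univ.filter fun p : Fin n × Fin n =>
      p.1 < p.2 ∧ ¬ G.Adj p.1 p.2 ∧ C.Same p.1 p.2).card +
  (Finset.univ.filter fun p : Fin n × Fin n =>
      p.1 < p.2 ∧ G.Adj p.1 p.2 ∧ ¬ C.Same p.1 p.2).card

/-- `C` has cost within an additive error `δ` of the minimum cost over all clusterings of `G`. -/
def IsApprox {n : ℕ} (G : SimpleGraph (Fin n)) (δ : ℝ) (C : Clustering n) : Prop :=
  ∀ C' : Clustering n, (cost G C : ℝ) ≤ (cost G C' : ℝ) + δ

open Classical in
/-- The degree of a vertex, as one of `0, …, n - 1`. -/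
noncomputable def deg {n : ℕ} (G : SimpleGraph (Fin n)) (v : Fin n) : Fin n :=
  ⟨G.degree v, by simpa using G.degree_lt_card_verts v⟩

/-- Adjacency lists of `G`: for each vertex `v` an enumeration of its neighbors. Positions are
counted from `0`. -/
abbrev NbrOrder {n : ℕ} (G : SimpleGraph (Fin n)) : Type :=
  (v : Fin n) → (Fin (deg G v : ℕ) ≃ G.neighborSet v)

noncomputable instance {n : ℕ} (G : SimpleGraph (Fin n)) : Fintype (NbrOrder G) := by
  classical exact inferInstance

instance {n : ℕ} (G : SimpleGraph (Fin n)) : Nonempty (NbrOrder G) := by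
  classical
  refine ⟨fun v => Fintype.equivOfCardEq ?_⟩
  rw [Fintype.card_fin, SimpleGraph.card_neighborSet_eq_degree]
  simp only [deg]

/-- A deterministic adaptive algorithm in the general graph model on the vertex set `Fin n`: a
decision tree whose leaves output a clustering and whose inner nodes ask
* a degree query (answered by a number below `n`),
* a neighbor query (answered by the vertex at position `i` of the list of `v`, or by `none` if the
  list is too short), or
* a pair query (answered by whether the pair is an edge). -/
inductive QueryAlg (n : ℕ) : Type
  | output (C : Clustering n) : QueryAlg n
  | degree (v : Fin n) (next : Fin n → QueryAlg n) : QueryAlg n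
  | neighbor (v : Fin n) (i : ℕ) (next : Option (Fin n) → QueryAlg n) : QueryAlg n
  | pair (u v : Fin n) (next : Bool → QueryAlg n) : QueryAlg n

/-- The answer to a neighbor query. -/
noncomputable def nbrAnswer {n : ℕ} (G : SimpleGraph (Fin n)) (L : NbrOrder G) (v : Fin n)
    (i : ℕ) : Option (Fin n) :=
  if h : i < (deg G v : ℕ) then some (L v ⟨i, h⟩ : Fin n) else none

open Classical in
/-- The answer to a pair query. -/
noncomputable def pairAnswer {n : ℕ} (G : SimpleGraph (Fin n)) (u v : Fin n) : Bool :=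
  decide (G.Adj u v)

/-- The clustering that the algorithm outputs on the graph `G` with adjacency lists `L`. -/
noncomputable def QueryAlg.result {n : ℕ} (G : SimpleGraph (Fin n)) (L : NbrOrder G) :
    QueryAlg n → Clustering n
  | .output C => C
  | .degree v next => (next (deg G v)).result G L
  | .neighbor v i next => (next (nbrAnswer G L v i)).result G L
  | .pair u v next => (next (pairAnswer G u v)).result G L

/-- The number of queries that the algorithm makes on the graph `G` with adjacency lists `L`. -/
noncomputable def QueryAlg.numQueries {n : ℕ} (G : SimpleGraph (Fin n)) (L : NbrOrder G) :
    QueryAlg n → ℕ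
  | .output _ => 0
  | .degree v next => (next (deg G v)).numQueries G L + 1
  | .neighbor v i next => (next (nbrAnswer G L v i)).numQueries G L + 1
  | .pair u v next => (next (pairAnswer G u v)).numQueries G L + 1

/-- A randomized algorithm: a probability distribution over deterministic ones. (There are only
countably many of these, as every node has finitely many children, so `PMF` covers all
distributions.) -/
abbrev RandQueryAlg (n : ℕ) : Type := PMF (QueryAlg n)

/-- The distribution of the output on the graph `G`, over the randomness of the algorithm and over
independent, uniformly random orders of the adjacency lists of `G`. -/
noncomputable def RandQueryAlg.outputDist {n : ℕ} (A : RandQueryAlg n)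
    (G : SimpleGraph (Fin n)) : PMF (Clustering n) :=
  A.bind fun T => (PMF.uniformOfFintype (NbrOrder G)).map fun L => T.result G L

/-- On every graph with `n` vertices, the algorithm outputs a clustering with additive error at most
`δ` with probability at least `p`. -/
def RandQueryAlg.Solves {n : ℕ} (A : RandQueryAlg n) (δ : ℝ) (p : ℝ≥0∞) : Prop :=
  ∀ G : SimpleGraph (Fin n), p ≤ (A.outputDist G).toOuterMeasure {C | IsApprox G δ C}

/-- The worst-case query complexity: the supremum of the number of queries over the random choices
of the algorithm, over all graphs and over all orders of their adjacency lists. -/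
noncomputable def RandQueryAlg.worstCaseQueries {n : ℕ} (A : RandQueryAlg n) : ℕ∞ :=
  ⨆ T ∈ A.support, ⨆ G : SimpleGraph (Fin n), ⨆ L : NbrOrder G, (T.numQueries G L : ℕ∞)

end CorrClust

/-! Each of `k * (2 * R)` indices `w`, about `n / 4` of them, hides a label `σ w` out of `k ~ 1/ε`.
The vertices `(i, x, y, r)` form cliques `(i, x)`, which are crossed by blocks `y`. The copy `(w,
s)` of `w` sees, for every label `i`, the vertices with `y = s`; only for `i = σ w` does it see the
clique `(σ w, s)` instead.

Degrees do not depend on `σ`, and any other query shows at most one bit `σ w = i`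
(`nbrAnswer_orderEquiv`, `pairAnswer_hardGraph`). Hence, once the orders in a reference graph are
fixed, an algorithm is a decision tree on `σ`. Locating one label takes about `k` questions, so far
fewer than `n * k ~ n/ε` queries leave most labels unknown (`DecTree.sum_score_le`).

A near-optimal clustering has to know labels. Up to lower order terms, placing each copy with its
clique has gain `16 k R²` for typical `σ` (`le_gain_planted`), whereas every clustering has gain at
most `12 k R²` plus four times a score that measures how well it matches copies with their labels
(`gain_le_score`). The gap exceeds the allowed error, so Markov's inequality over uniform `σ` bounds
the success probability by `1/4 < 1/3` (`card_isApprox_le`, `not_solves`). -/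

namespace CorrClust

/-! ### Guessing hidden labels with equality questions. -/

/-- Decision trees over inputs `σ : ι → κ` whose inner nodes ask whether `σ w = i`. -/
inductive DecTree (ι κ α : Type*)
  | leaf (a : α) : DecTree ι κ α
  | ask (w : ι) (i : κ) (yes no : DecTree ι κ α) : DecTree ι κ α

namespace DecTree

variable {ι κ α : Type*}

/-- The output of the tree on the input `σ`. -/
def eval [DecidableEq κ] (σ : ι → κ) : DecTree ι κ α → α
  | .leaf a => a
  | .ask w i yes no => if σ w = i then yes.eval σ else no.eval σ

/-- The number of questions that the tree asks on the input `σ`. -/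
def numAsk [DecidableEq κ] (σ : ι → κ) : DecTree ι κ α → ℕ
  | .leaf _ => 0
  | .ask w i yes no => (if σ w = i then yes.numAsk σ else no.numAsk σ) + 1

/-- Upper bound for the chance to guess a label of which `s` out of `k` values are still possible,
when a guess may be spread over `A` values. -/
noncomputable def potential (k : ℕ) (A : ℝ) (s : ℕ) : ℝ := min 1 (2 * (k - s + A) / k)

lemma potential_le_one (k : ℕ) (A : ℝ) (s : ℕ) : potential k A s ≤ 1 := min_le_left _ _

/-- The price of one question. While the potential is below `1`, at least half of the values are
possible: a hit has chance `1 / (s + 1) ≤ 2 / k` and gains at most `1`, and a miss removes one value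
and gains at most `2 / k`. -/
lemma potential_split {k : ℕ} {A : ℝ} (hA : 0 ≤ A) {s : ℕ} (hs : s + 1 ≤ k) :
    potential k A 1 + s * potential k A s ≤ (s + 1) * (potential k A (s + 1) + 4 / k) := by
  have hk : (0 : ℝ) < k := by exact_mod_cast (by omega : 0 < k)
  have hsk : (s : ℝ) + 1 ≤ k := by exact_mod_cast hs
  have h1 := potential_le_one k A 1
  have h2 := potential_le_one k A s
  have hs0 : (0 : ℝ) ≤ s := s.cast_nonneg
  have h4 : (0 : ℝ) ≤ 4 / k := by positivity
  rcases le_total 1 (2 * ((k : ℝ) - ((s + 1 : ℕ) : ℝ) + A) / k) with h | h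
  · have h3 : potential k A (s + 1) = 1 := min_eq_left h
    rw [h3]
    nlinarith
  · have h3 : potential k A (s + 1) = 2 * ((k : ℝ) - ((s + 1 : ℕ) : ℝ) + A) / k := min_eq_right h
    have h5 : potential k A s ≤ potential k A (s + 1) + 2 / k := by
      rw [h3]
      refine (min_le_right _ _).trans (le_of_eq ?_)
      push_cast
      ring
    have h6 : 0 ≤ potential k A (s + 1) := by
      rw [h3]
      push_cast
      exact div_nonneg (by linarith) hk.le
    have h7 : 1 ≤ 2 * (s + 1) / (k : ℝ) := by
      rw [div_le_one hk] at h
      push_cast at h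
      rw [le_div_iff₀ hk]
      linarith
    have h8 : (s + 1 : ℝ) * (4 / k) = 2 * (2 * (s + 1) / k) := by ring
    have h9 : (s : ℝ) * (2 / k) ≤ 2 * (s + 1) / k := by
      rw [mul_div_assoc', mul_comm]
      gcongr
      linarith
    nlinarith

/-- If `S` has at least half of the values, the total mass `A` spread over `S` gives the bound;
otherwise the potential is `1`. -/
lemma sum_le_potential [Fintype κ] {A : ℝ} (hA : 0 ≤ A) {f : κ → ℝ} (hf0 : ∀ i, 0 ≤ f i)
    (hf1 : ∀ i, f i ≤ 1) (hfA : ∑ i, f i ≤ A) (S : Finset κ) :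
    ∑ i ∈ S, f i ≤ S.card * potential (Fintype.card κ) A S.card := by
  rcases S.eq_empty_or_nonempty with rfl | hS
  · simp
  have hk : (0 : ℝ) < Fintype.card κ := by
    exact_mod_cast hS.card_pos.trans_le S.card_le_univ
  have hle : (S.card : ℝ) ≤ Fintype.card κ := by exact_mod_cast S.card_le_univ
  rw [potential, mul_min_of_nonneg _ _ (by positivity), mul_one]
  refine le_min ?_ ?_
  · simpa using Finset.sum_le_sum fun i (_ : i ∈ S) => hf1 i
  · have h1 : ∑ i ∈ S, f i ≤ A :=
      (Finset.sum_le_univ_sum_of_nonneg hf0).trans hfA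
    have h2 : ∑ i ∈ S, f i ≤ S.card := by
      simpa using Finset.sum_le_sum fun i (_ : i ∈ S) => hf1 i
    rw [mul_div_assoc', le_div_iff₀ hk]
    have hS1 : (1 : ℝ) ≤ S.card := by exact_mod_cast hS.card_pos
    rcases le_total (Fintype.card κ : ℝ) (2 * S.card) with h | h
    · have : A * Fintype.card κ ≤ A * (2 * S.card) := by gcongr
      nlinarith
    · have : (∑ i ∈ S, f i) * Fintype.card κ ≤ S.card * Fintype.card κ := by gcongr
      nlinarith

variable [Fintype ι] [DecidableEq ι]

lemma card_piFinset_update (S : ι → Finset κ) (w : ι) (B : Finset κ) :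
    (Fintype.piFinset (Function.update S w B)).card
      = B.card * ∏ v ∈ Finset.univ.erase w, (S v).card := by
  rw [Fintype.card_piFinset, ← Finset.mul_prod_erase _ _ (Finset.mem_univ w),
    Function.update_self]
  congr 1
  refine Finset.prod_congr rfl fun v hv => ?_
  rw [Function.update_of_ne (Finset.ne_of_mem_erase hv)]

lemma filter_piFinset (S : ι → Finset κ) (w : ι) (p : κ → Prop) [DecidablePred p] :
    (Fintype.piFinset S).filter (fun σ => p (σ w))
      = Fintype.piFinset (Function.update S w ((S w).filter p)) := by
  ext σ
  simp only [Finset.mem_filter, Fintype.mem_piFinset]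
  constructor
  · rintro ⟨h, hp⟩ v
    rcases eq_or_ne v w with rfl | hv
    · simp [h v, hp]
    · simp [hv, h v]
  · intro h
    have hw := h w
    simp only [Function.update_self, Finset.mem_filter] at hw
    refine ⟨fun v => ?_, hw.2⟩
    rcases eq_or_ne v w with rfl | hv
    · exact hw.1
    · simpa [hv] using h v

lemma sum_piFinset_apply [DecidableEq κ] (S : ι → Finset κ) (w : ι) (f : κ → ℝ) :
    ∑ σ ∈ Fintype.piFinset S, f (σ w)
      = (∏ v ∈ Finset.univ.erase w, (S v).card) * ∑ i ∈ S w, f i := by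
  rw [← Finset.sum_fiberwise_of_maps_to (t := S w) (g := fun σ => σ w)
    (fun σ hσ => Fintype.mem_piFinset.1 hσ w), Finset.mul_sum]
  refine Finset.sum_congr rfl fun i hi => ?_
  rw [Finset.sum_congr rfl (g := fun _ => f i)
    (fun σ hσ => by rw [(Finset.mem_filter.1 hσ).2]), Finset.sum_const, nsmul_eq_mul]
  congr 1
  rw [filter_piFinset S w (fun j => j = i), card_piFinset_update, Finset.filter_eq', if_pos hi]
  simp

/-- The inputs consistent with the answers so far always form a box `∏ S w`, so the induction runs
over all boxes, and a question splits a single side of the box. -/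
theorem sum_score_le_potential [DecidableEq κ] [Fintype κ] {A : ℝ} (hA : 0 ≤ A) {g : α → ι → κ → ℝ}
    (hg0 : ∀ a w i, 0 ≤ g a w i) (hg1 : ∀ a w i, g a w i ≤ 1)
    (hgA : ∀ a w, ∑ i, g a w i ≤ A) (T : DecTree ι κ α) : ∀ S : ι → Finset κ,
    ∑ σ ∈ Fintype.piFinset S,
        (∑ w, g (T.eval σ) w (σ w) - 4 / Fintype.card κ * T.numAsk σ)
      ≤ (Fintype.piFinset S).card * ∑ w, potential (Fintype.card κ) A (S w).card := by
  induction T with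
  | leaf a =>
    intro S
    simp only [eval, numAsk, Nat.cast_zero, mul_zero, sub_zero]
    rw [Finset.sum_comm, Finset.mul_sum]
    refine Finset.sum_le_sum fun w _ => ?_
    rw [sum_piFinset_apply S w (fun i => g a w i)]
    have h := sum_le_potential hA (hg0 a w) (hg1 a w) (hgA a w) (S w)
    rw [Fintype.card_piFinset, ← Finset.mul_prod_erase _ _ (Finset.mem_univ w)]
    push_cast
    rw [mul_comm ((S w).card : ℝ), mul_assoc]
    gcongr
  | ask w i yes no ihy ihn =>
    intro S
    set k := Fintype.card κ
    rw [← Finset.sum_filter_add_sum_filter_not _ (fun σ => σ w = i)]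
    have hy := ihy (Function.update S w ((S w).filter (· = i)))
    have hn := ihn (Function.update S w ((S w).filter (¬ · = i)))
    rw [← filter_piFinset] at hy hn
    have ey : ∑ σ ∈ (Fintype.piFinset S).filter (fun σ => σ w = i),
        (∑ v, g ((ask w i yes no).eval σ) v (σ v) - 4 / k * ((ask w i yes no).numAsk σ : ℕ))
        = ∑ σ ∈ (Fintype.piFinset S).filter (fun σ => σ w = i),
          (∑ v, g (yes.eval σ) v (σ v) - 4 / k * (yes.numAsk σ : ℕ))
          - ((Fintype.piFinset S).filter (fun σ => σ w = i)).card * (4 / k) := by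
      rw [← nsmul_eq_mul, ← Finset.sum_const, ← Finset.sum_sub_distrib]
      refine Finset.sum_congr rfl fun σ hσ => ?_
      simp only [eval, numAsk, if_pos (Finset.mem_filter.1 hσ).2]
      push_cast
      ring
    have en : ∑ σ ∈ (Fintype.piFinset S).filter (fun σ => ¬ σ w = i),
        (∑ v, g ((ask w i yes no).eval σ) v (σ v) - 4 / k * ((ask w i yes no).numAsk σ : ℕ))
        = ∑ σ ∈ (Fintype.piFinset S).filter (fun σ => ¬ σ w = i),
          (∑ v, g (no.eval σ) v (σ v) - 4 / k * (no.numAsk σ : ℕ))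
          - ((Fintype.piFinset S).filter (fun σ => ¬ σ w = i)).card * (4 / k) := by
      rw [← nsmul_eq_mul, ← Finset.sum_const, ← Finset.sum_sub_distrib]
      refine Finset.sum_congr rfl fun σ hσ => ?_
      simp only [eval, numAsk, if_neg (Finset.mem_filter.1 hσ).2]
      push_cast
      ring
    rw [ey, en]
    have hrest : ∀ B : Finset κ, ∑ v, potential k A (Function.update S w B v).card
        = potential k A B.card + ∑ v ∈ Finset.univ.erase w, potential k A (S v).card := by
      intro B
      rw [← Finset.add_sum_erase _ _ (Finset.mem_univ w), Function.update_self]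
      congr 1
      refine Finset.sum_congr rfl fun v hv => ?_
      rw [Function.update_of_ne (Finset.ne_of_mem_erase hv)]
    have hS := hrest (S w)
    rw [Function.update_eq_self] at hS
    have hcS := card_piFinset_update S w (S w)
    rw [Function.update_eq_self] at hcS
    rw [hrest] at hy hn
    rw [filter_piFinset S w (fun j => j = i), card_piFinset_update] at hy ⊢
    rw [filter_piFinset S w (fun j => ¬ j = i), card_piFinset_update] at hn ⊢
    rw [hS, hcS]
    set N := ∏ v ∈ Finset.univ.erase w, (S v).card
    set R := ∑ v ∈ Finset.univ.erase w, potential k A (S v).card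
    have hN : (0 : ℝ) ≤ N := N.cast_nonneg
    have h4 : (0 : ℝ) ≤ 4 / k := by positivity
    have hsum := Finset.card_filter_add_card_filter_not (s := S w) (fun j => j = i)
    by_cases hi : i ∈ S w
    · have h1 : ((S w).filter (· = i)).card = 1 := by
        rw [Finset.filter_eq', if_pos hi, Finset.card_singleton]
      rw [h1] at hsum hy ⊢
      set s := ((S w).filter (¬ · = i)).card
      have hs : (S w).card = s + 1 := by omega
      have hp := potential_split (k := k) hA (s := s) (hs ▸ (S w).card_le_univ)
      rw [hs]
      clear_value N R s k
      simp only [Nat.cast_mul, Nat.cast_add, Nat.cast_one, one_mul] at hy hn ⊢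
      linear_combination hy + hn + (N : ℝ) * hp
    -- The value `i` is already excluded: the question is wasted and the box does not change.
    · have h1 : ((S w).filter (· = i)).card = 0 := by
        rw [Finset.filter_eq', if_neg hi, Finset.card_empty]
      rw [h1] at hsum hy ⊢
      rw [zero_add] at hsum
      rw [hsum] at hn ⊢
      rw [zero_mul, Nat.cast_zero, zero_mul] at hy ⊢
      have : 0 ≤ (((S w).card * N : ℕ) : ℝ) * (4 / k) := mul_nonneg (Nat.cast_nonneg _) h4
      clear_value N R k
      linear_combination hy + hn + this

/-- The expected score of a decision tree for a uniformly random input. -/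
theorem sum_score_le [DecidableEq κ] [Fintype κ] {A : ℝ} (hA : 0 ≤ A) {g : α → ι → κ → ℝ}
    (hg0 : ∀ a w i, 0 ≤ g a w i) (hg1 : ∀ a w i, g a w i ≤ 1)
    (hgA : ∀ a w, ∑ i, g a w i ≤ A) (T : DecTree ι κ α) {q : ℝ}
    (hq : ∀ σ, (T.numAsk σ : ℝ) ≤ q) :
    ∑ σ : ι → κ, ∑ w, g (T.eval σ) w (σ w)
      ≤ Fintype.card (ι → κ) * ((2 * A * Fintype.card ι + 4 * q) / Fintype.card κ) := by
  have h := sum_score_le_potential hA hg0 hg1 hgA T (fun _ => Finset.univ)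
  rw [Fintype.piFinset_univ] at h
  rw [Finset.sum_sub_distrib] at h
  have h1 : ∑ σ : ι → κ, 4 / (Fintype.card κ : ℝ) * T.numAsk σ
      ≤ Fintype.card (ι → κ) * (4 / (Fintype.card κ : ℝ) * q) := by
    rw [← nsmul_eq_mul, ← Finset.card_univ (α := ι → κ), ← Finset.sum_const]
    refine Finset.sum_le_sum fun σ _ => ?_
    have := hq σ
    gcongr
  have h2 : ∑ _w : ι, potential (Fintype.card κ) A (Finset.univ : Finset κ).card
      ≤ Fintype.card ι * (2 * A / Fintype.card κ) := by
    rw [Finset.sum_const, nsmul_eq_mul, Finset.card_univ]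
    gcongr
    refine (min_le_right _ _).trans (le_of_eq ?_)
    rw [Finset.card_univ]
    ring
  have h3 : ((Finset.univ : Finset (ι → κ)).card : ℝ)
        * ∑ _w : ι, potential (Fintype.card κ) A (Finset.univ : Finset κ).card
      ≤ Fintype.card (ι → κ) * (Fintype.card ι * (2 * A / Fintype.card κ)) := by
    rw [Finset.card_univ]
    gcongr
  calc _ ≤ Fintype.card (ι → κ) * (Fintype.card ι * (2 * A / Fintype.card κ))
        + Fintype.card (ι → κ) * (4 / (Fintype.card κ : ℝ) * q) := by linarith
    _ = _ := by ring

end DecTree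

/-! ### The hard graphs, and queries as questions about the labels. -/

namespace DecTree

variable {ι κ α : Type*} [DecidableEq κ]

/-- The truth value of `σ w = i` for `t = some (w, i)`, and `false` for `t = none`. -/
def bit (σ : ι → κ) : Option (ι × κ) → Bool
  | none => false
  | some p => decide (σ p.1 = p.2)

/-- The tree that asks for the bit given by `t`, if any, and goes on with `f`. -/
def branch (t : Option (ι × κ)) (f : Bool → DecTree ι κ α) : DecTree ι κ α :=
  match t with
  | none => f false
  | some p => .ask p.1 p.2 (f true) (f false)

lemma eval_branch (σ : ι → κ) (t : Option (ι × κ)) (f : Bool → DecTree ι κ α) :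
    (branch t f).eval σ = (f (bit σ t)).eval σ := by
  rcases t with _ | p
  · rfl
  · by_cases h : σ p.1 = p.2 <;> simp [branch, bit, eval, h]

lemma numAsk_branch_le (σ : ι → κ) (t : Option (ι × κ)) (f : Bool → DecTree ι κ α) :
    (branch t f).numAsk σ ≤ (f (bit σ t)).numAsk σ + 1 := by
  rcases t with _ | p
  · simp [branch, bit]
  · by_cases h : σ p.1 = p.2 <;> simp [branch, bit, numAsk, h]

end DecTree

/-- The vertices of the hard graphs. The first kind carries a clique label, two block coordinates
and a running index, the second kind a hidden label and one block coordinate, and the third kind is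
isolated. -/
abbrev Vtx (k D R M Z : ℕ) : Type :=
  (Fin k × Fin D × Fin D × Fin R) ⊕ (Fin M × Fin D) ⊕ Fin Z

namespace Vtx

variable {k D R M Z : ℕ}

/-- The change of the slot `z` in the adjacency list of `v` when the labels match. -/
def flip (b : Bool) : Vtx k D R M Z → Vtx k D R M Z → Vtx k D R M Z
  | .inl (_, x, y, _), .inr (.inl (w, s)) => .inr (.inl (w, if b then Equiv.swap x y s else s))
  | .inr (.inl _), .inl (i, x, y, r) => .inl (if b then (i, y, x, r) else (i, x, y, r))
  | _, z => z

/-- The pair of a hidden vertex and a label on which the slot `z` of `v` depends. -/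
def touch : Vtx k D R M Z → Vtx k D R M Z → Option (Fin M × Fin k)
  | .inl (i, _, _, _), .inr (.inl (w, _)) => some (w, i)
  | .inr (.inl (w, _)), .inl (i, _, _, _) => some (w, i)
  | _, _ => none

/-- Adjacency in the graph where no labels match. -/
def RefAdj : Vtx k D R M Z → Vtx k D R M Z → Prop
  | .inl (i, x, y, r), .inl (i', x', y', r') => (i = i' ∧ x = x') ∧ ¬ (y = y' ∧ r = r')
  | .inl (_, _, y, _), .inr (.inl (_, s)) => y = s
  | .inr (.inl (_, s)), .inl (_, _, y, _) => y = s
  | _, _ => False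

/-- Adjacency in the graph with hidden labels `σ`. -/
def Adj (σ : Fin M → Fin k) : Vtx k D R M Z → Vtx k D R M Z → Prop
  | .inl (i, x, y, r), .inl (i', x', y', r') => (i = i' ∧ x = x') ∧ ¬ (y = y' ∧ r = r')
  | .inl (i, x, y, _), .inr (.inl (w, s)) => if σ w = i then x = s else y = s
  | .inr (.inl (w, s)), .inl (i, x, y, _) => if σ w = i then x = s else y = s
  | _, _ => False

/-- Whether the slot `z` of `v` is changed by the labels `σ`. -/
def hit (σ : Fin M → Fin k) (v z : Vtx k D R M Z) : Bool := DecTree.bit σ (touch v z)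

lemma flip_false (v z : Vtx k D R M Z) : flip false v z = z := by
  rcases v with ⟨i, x, y, r⟩ | ⟨w, s⟩ | l <;> rcases z with ⟨i', x', y', r'⟩ | ⟨w', s'⟩ | l' <;>
    simp [flip]

lemma flip_flip (b : Bool) (v z : Vtx k D R M Z) : flip b v (flip b v z) = z := by
  cases b
  · simp [flip_false]
  rcases v with ⟨i, x, y, r⟩ | ⟨w, s⟩ | l <;> rcases z with ⟨i', x', y', r'⟩ | ⟨w', s'⟩ | l' <;>
    simp [flip]

lemma touch_flip (b : Bool) (v z : Vtx k D R M Z) : touch v (flip b v z) = touch v z := by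
  cases b
  · simp [flip_false]
  rcases v with ⟨i, x, y, r⟩ | ⟨w, s⟩ | l <;> rcases z with ⟨i', x', y', r'⟩ | ⟨w', s'⟩ | l' <;>
    simp [flip, touch]

lemma hit_flip (σ : Fin M → Fin k) (b : Bool) (v z : Vtx k D R M Z) :
    hit σ v (flip b v z) = hit σ v z := by
  rw [hit, touch_flip, hit]

/-- Each slot of the reference graph moves by an involution that depends on a single bit. The
involution preserves that bit, so the bit can be read from either end of the correspondence. -/
lemma adj_iff (σ : Fin M → Fin k) (v z : Vtx k D R M Z) :
    Adj σ v z ↔ RefAdj v (flip (hit σ v z) v z) := by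
  rcases v with ⟨i, x, y, r⟩ | ⟨w, s⟩ | l <;> rcases z with ⟨i', x', y', r'⟩ | ⟨w', s'⟩ | l'
  · simp [Adj, RefAdj, flip]
  · by_cases h : σ w' = i
    · simp only [Adj, h, if_true, RefAdj, flip, hit, touch, DecTree.bit, decide_true]
      rw [eq_comm (a := y), ← Equiv.eq_symm_apply, Equiv.symm_swap,
        Equiv.swap_apply_right, eq_comm]
    · simp [Adj, RefAdj, flip, hit, touch, DecTree.bit, h]
  · simp [Adj, RefAdj, flip]
  · by_cases h : σ w = i' <;> simp [Adj, RefAdj, flip, hit, touch, DecTree.bit, h]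
  all_goals simp [Adj, RefAdj, flip]

lemma Adj.symm {σ : Fin M → Fin k} {v z : Vtx k D R M Z} (h : Adj σ v z) : Adj σ z v := by
  rcases v with ⟨i, x, y, r⟩ | ⟨w, s⟩ | l <;> rcases z with ⟨i', x', y', r'⟩ | ⟨w', s'⟩ | l'
  · obtain ⟨⟨h1, h2⟩, h3⟩ := h
    exact ⟨⟨h1.symm, h2.symm⟩, fun h => h3 ⟨h.1.symm, h.2.symm⟩⟩
  all_goals exact h

lemma not_adj_self (σ : Fin M → Fin k) (v : Vtx k D R M Z) : ¬ Adj σ v v := by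
  rcases v with ⟨i, x, y, r⟩ | ⟨w, s⟩ | l <;> simp [Adj]

lemma RefAdj.symm {v z : Vtx k D R M Z} (h : RefAdj v z) : RefAdj z v := by
  rcases v with ⟨i, x, y, r⟩ | ⟨w, s⟩ | l <;> rcases z with ⟨i', x', y', r'⟩ | ⟨w', s'⟩ | l'
  · obtain ⟨⟨h1, h2⟩, h3⟩ := h
    exact ⟨⟨h1.symm, h2.symm⟩, fun h => h3 ⟨h.1.symm, h.2.symm⟩⟩
  all_goals exact h

lemma not_refAdj_self (v : Vtx k D R M Z) : ¬ RefAdj v v := by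
  rcases v with ⟨i, x, y, r⟩ | ⟨w, s⟩ | l <;> simp [RefAdj]

end Vtx

section Simulation

variable {k D R M Z n : ℕ} (e : Fin n ≃ Vtx k D R M Z)

/-- The hard graph with hidden labels `σ`. -/
def hardGraph (σ : Fin M → Fin k) : SimpleGraph (Fin n) where
  Adj u v := Vtx.Adj σ (e u) (e v)
  symm := ⟨fun _ _ h => Vtx.Adj.symm h⟩
  loopless := ⟨fun v => Vtx.not_adj_self σ (e v)⟩

/-- The graph in which no labels match. -/
def refGraph : SimpleGraph (Fin n) where
  Adj u v := Vtx.RefAdj (e u) (e v)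
  symm := ⟨fun _ _ h => Vtx.RefAdj.symm h⟩
  loopless := ⟨fun v => Vtx.not_refAdj_self (e v)⟩

/-- `Vtx.flip` on `Fin n`. -/
def flipVertex (b : Bool) (v z : Fin n) : Fin n := e.symm (Vtx.flip b (e v) (e z))

/-- The neighbors of `v` in the hard graph correspond to those in the reference graph. -/
def nbrEquiv (σ : Fin M → Fin k) (v : Fin n) :
    (refGraph e).neighborSet v ≃ (hardGraph e σ).neighborSet v where
  toFun z := ⟨flipVertex e (Vtx.hit σ (e v) (e z)) v z, by
    have h : Vtx.RefAdj (e v) (e z) := z.2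
    change Vtx.Adj σ (e v) (e (flipVertex e _ v z))
    rwa [Vtx.adj_iff, flipVertex, Equiv.apply_symm_apply, Vtx.hit_flip, Vtx.flip_flip]⟩
  invFun z := ⟨flipVertex e (Vtx.hit σ (e v) (e z)) v z, by
    have h : Vtx.Adj σ (e v) (e z) := z.2
    change Vtx.RefAdj (e v) (e (flipVertex e _ v z))
    rwa [flipVertex, Equiv.apply_symm_apply, ← Vtx.adj_iff]⟩
  left_inv z := by
    ext1
    simp [flipVertex, Vtx.hit_flip, Vtx.flip_flip]
  right_inv z := by
    ext1
    simp [flipVertex, Vtx.hit_flip, Vtx.flip_flip]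

/-- Degree queries are free. For instance, a clique vertex sees exactly one copy of each `w`,
whatever `σ` is. -/
lemma deg_hardGraph (σ : Fin M → Fin k) (v : Fin n) :
    deg (hardGraph e σ) v = deg (refGraph e) v := by
  classical
  ext
  simp only [deg]
  rw [← SimpleGraph.card_neighborSet_eq_degree, ← SimpleGraph.card_neighborSet_eq_degree]
  exact (Fintype.card_congr (nbrEquiv e σ v)).symm

/-- Adjacency lists of the reference graph correspond to those of the hard graph. -/
noncomputable def orderEquiv (σ : Fin M → Fin k) : NbrOrder (refGraph e) ≃ NbrOrder (hardGraph e σ) :=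
  Equiv.piCongrRight fun v =>
    Equiv.equivCongr (finCongr (by rw [deg_hardGraph])) (nbrEquiv e σ v)

/-- Positions in the lists are kept, so the reference order and one bit determine the answer. As
`orderEquiv` is a bijection, uniform orders remain uniform. -/
lemma nbrAnswer_orderEquiv (σ : Fin M → Fin k) (L : NbrOrder (refGraph e)) (v : Fin n) (i : ℕ) :
    nbrAnswer (hardGraph e σ) (orderEquiv e σ L) v i
      = (nbrAnswer (refGraph e) L v i).map fun z =>
          flipVertex e (Vtx.hit σ (e v) (e z)) v z := by
  have h := congrArg Fin.val (deg_hardGraph e σ v)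
  by_cases hi : i < (deg (refGraph e) v : ℕ)
  · rw [nbrAnswer, nbrAnswer, dif_pos hi, dif_pos (h ▸ hi)]
    rfl
  · rw [nbrAnswer, nbrAnswer, dif_neg hi, dif_neg (h ▸ hi)]
    rfl

open Classical in
lemma pairAnswer_hardGraph (σ : Fin M → Fin k) (u v : Fin n) :
    pairAnswer (hardGraph e σ) u v
      = decide ((refGraph e).Adj u (flipVertex e (Vtx.hit σ (e u) (e v)) u v)) := by
  rw [pairAnswer, decide_eq_decide]
  change Vtx.Adj σ (e u) (e v) ↔ Vtx.RefAdj (e u) (e (flipVertex e _ u v))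
  rw [flipVertex, Equiv.apply_symm_apply, Vtx.adj_iff]

open Classical in
/-- The decision tree on the hidden labels that an algorithm becomes for fixed adjacency lists of
the reference graph. -/
noncomputable def QueryAlg.toDecTree (L : NbrOrder (refGraph e)) :
    QueryAlg n → DecTree (Fin M) (Fin k) (Clustering n)
  | .output C => .leaf C
  | .degree v next => (next (deg (refGraph e) v)).toDecTree L
  | .neighbor v i next =>
    match nbrAnswer (refGraph e) L v i with
    | none => (next none).toDecTree L
    | some z => .branch (Vtx.touch (e v) (e z)) fun b =>
        (next (some (flipVertex e b v z))).toDecTree L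
  | .pair u v next => .branch (Vtx.touch (e u) (e v)) fun b =>
      (next (decide ((refGraph e).Adj u (flipVertex e b u v)))).toDecTree L

lemma QueryAlg.eval_toDecTree (L : NbrOrder (refGraph e)) (σ : Fin M → Fin k) (T : QueryAlg n) :
    (T.toDecTree e L).eval σ = T.result (hardGraph e σ) (orderEquiv e σ L) := by
  induction T with
  | output C => rfl
  | degree v next ih => rw [toDecTree, ih, result, deg_hardGraph]
  | neighbor v i next ih =>
    rw [toDecTree, result, nbrAnswer_orderEquiv]
    rcases nbrAnswer (refGraph e) L v i with _ | z
    · exact ih none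
    · simp only [Option.map_some, DecTree.eval_branch, ih]
      rfl
  | pair u v next ih =>
    rw [toDecTree, result, pairAnswer_hardGraph, DecTree.eval_branch, ih]
    rfl

lemma QueryAlg.numAsk_toDecTree_le (L : NbrOrder (refGraph e)) (σ : Fin M → Fin k)
    (T : QueryAlg n) :
    (T.toDecTree e L).numAsk σ ≤ T.numQueries (hardGraph e σ) (orderEquiv e σ L) := by
  induction T with
  | output C => exact le_rfl
  | degree v next ih =>
    rw [toDecTree, numQueries, deg_hardGraph]
    exact (ih _).trans (Nat.le_succ _)
  | neighbor v i next ih =>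
    rw [toDecTree, numQueries, nbrAnswer_orderEquiv]
    rcases nbrAnswer (refGraph e) L v i with _ | z
    · exact (ih none).trans (Nat.le_succ _)
    · exact (DecTree.numAsk_branch_le _ _ _).trans (Nat.succ_le_succ (ih _))
  | pair u v next ih =>
    rw [toDecTree, numQueries, pairAnswer_hardGraph]
    exact (DecTree.numAsk_branch_le _ _ _).trans (Nat.succ_le_succ (ih _))

end Simulation

/-! ### The gain of a single cluster as a quadratic form. -/

namespace Vtx

open Classical in
/-- The quadratic form whose value on the indicator of a cluster measures the gain of that
cluster. -/
noncomputable def sgn {k D R M Z : ℕ} (σ : Fin M → Fin k) (v z : Vtx k D R M Z) : ℝ :=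
  2 * (if Adj σ v z then 1 else 0) - 1

section Quadratic

variable {k D R M Z : ℕ} (σ : Fin M → Fin k)

/-- The weight of the vertices with given clique label and block coordinates. -/
def cell (χ : Vtx k D R M Z → ℝ) (i : Fin k) (x y : Fin D) : ℝ := ∑ r, χ (.inl (i, x, y, r))

/-- The weight of the block with second coordinate `y`. -/
def block (χ : Vtx k D R M Z → ℝ) (y : Fin D) : ℝ := ∑ i, ∑ x, cell χ i x y

open Classical in
/-- The weight of the vertices matching the label `i` in coordinate `s`, in the blocks of small
weight. -/
noncomputable def matchWeight (χ : Vtx k D R M Z → ℝ) (i : Fin k) (s : Fin D) : ℝ :=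
  ∑ y, if block χ y ≤ 2 * R then cell χ i s y else 0

lemma sum_block (χ : Vtx k D R M Z → ℝ) :
    ∑ y, block χ y = ∑ u : Fin k × Fin D × Fin D × Fin R, χ (.inl u) := by
  simp only [block, cell, Fintype.sum_prod_type]
  rw [Finset.sum_comm]
  refine Finset.sum_congr rfl fun i _ => ?_
  rw [Finset.sum_comm]

open Classical in
lemma sum_clique_le {χ : Vtx k D R M Z → ℝ} (h0 : ∀ v, 0 ≤ χ v) :
    ∑ u, ∑ u', χ (.inl u) * χ (.inl u') * (if Adj (Z := Z) σ (.inl u) (.inl u') then 1 else 0)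
      ≤ ∑ i, ∑ x, (∑ y, cell χ i x y) ^ 2 := by
  have h : ∀ u : Fin k × Fin D × Fin D × Fin R,
      ∑ u', χ (.inl u) * χ (.inl u') * (if Adj (Z := Z) σ (.inl u) (.inl u') then 1 else 0)
        ≤ χ (.inl u) * ∑ y, cell χ u.1 u.2.1 y := by
    rintro ⟨i, x, y, r⟩
    have e : ∑ y', cell χ i x y' = ∑ u' : Fin k × Fin D × Fin D × Fin R,
        if i = u'.1 then (if x = u'.2.1 then χ (.inl u') else 0) else 0 := by
      simp only [Fintype.sum_prod_type, cell, Finset.sum_ite_irrel, Finset.sum_ite_eq,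
        Finset.mem_univ, if_true, Finset.sum_const_zero]
      symm
      rw [Finset.sum_eq_single_of_mem x (Finset.mem_univ x) fun x' _ h => by simp [h.symm]]
      simp
    rw [e, Finset.mul_sum]
    refine Finset.sum_le_sum fun u' _ => ?_
    obtain ⟨i', x', y', r'⟩ := u'
    rw [mul_assoc]
    refine mul_le_mul_of_nonneg_left ?_ (h0 _)
    have := h0 (.inl (i', x', y', r'))
    by_cases hi : i = i' <;> by_cases hx : x = x' <;> simp [Adj, hi, hx]
    split_ifs <;> linarith
  refine (Finset.sum_le_sum fun u _ => h u).trans (le_of_eq ?_)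
  simp only [Fintype.sum_prod_type, cell, sq, Finset.sum_mul]

-- The term `block χ s` is what a copy sees when no label matches; the rest is the part of its own
-- clique outside block `s`.
open Classical in
lemma sum_hidden_le {χ : Vtx k D R M Z → ℝ} (h0 : ∀ v, 0 ≤ χ v) (w : Fin M) (s : Fin D) :
    ∑ u, χ (.inl u) * (if Adj (Z := Z) σ (.inl u) (.inr (.inl (w, s))) then 1 else 0)
      ≤ block χ s + ∑ y, if y = s then 0 else cell χ (σ w) s y := by
  have e1 : block χ s = ∑ u : Fin k × Fin D × Fin D × Fin R,
      if u.2.2.1 = s then χ (.inl u) else 0 := by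
    simp only [Fintype.sum_prod_type, block, cell]
    refine Finset.sum_congr rfl fun i _ => Finset.sum_congr rfl fun x _ => ?_
    rw [Finset.sum_comm]
    simp
  have e2 : (∑ y, if y = s then 0 else cell χ (σ w) s y)
      = ∑ u : Fin k × Fin D × Fin D × Fin R,
        if σ w = u.1 then (if s = u.2.1 then (if u.2.2.1 = s then 0 else χ (.inl u)) else 0)
        else 0 := by
    simp only [Fintype.sum_prod_type, cell]
    simp only [Finset.sum_ite_irrel, Finset.sum_ite_eq, Finset.mem_univ, if_true,
      Finset.sum_const_zero]
    refine Finset.sum_congr rfl fun y _ => ?_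
    split_ifs <;> simp
  rw [e1, e2, ← Finset.sum_add_distrib]
  refine Finset.sum_le_sum fun u _ => ?_
  obtain ⟨i, x, y, r⟩ := u
  have := h0 (.inl (i, x, y, r))
  by_cases hi : σ w = i <;> by_cases hx : x = s <;> by_cases hy : y = s <;>
    simp [Adj, hi, hx, hy, eq_comm (a := s)]
  exact hy ▸ this

/-- A cell has weight at most `R`, hence at most half of its block once the block exceeds `2 * R`.
Large blocks are therefore charged to the total weight, and only small blocks need the matching
weight. -/
lemma cell_le_add {χ : Vtx k D R M Z → ℝ} (h0 : ∀ v, 0 ≤ χ v) (h1 : ∀ v, χ v ≤ 1)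
    (i : Fin k) (s : Fin D) :
    (∑ y, if y = s then 0 else cell χ i s y)
      ≤ matchWeight χ i s + (∑ y, block χ y - block χ s) / 2 := by
  have hc0 : ∀ i x y, 0 ≤ cell χ i x y := fun i x y => Finset.sum_nonneg fun r _ => h0 _
  have hcR : ∀ i x y, cell χ i x y ≤ R := fun i x y => by
    simpa [cell] using Finset.sum_le_sum fun r (_ : r ∈ Finset.univ) => h1 (.inl (i, x, y, r))
  have hb0 : ∀ y, 0 ≤ block χ y := fun y =>
    Finset.sum_nonneg fun i _ => Finset.sum_nonneg fun x _ => hc0 i x y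
  have e : ∑ y, block χ y - block χ s = ∑ y, if y = s then 0 else block χ y := by
    rw [← Finset.sum_erase_eq_sub (Finset.mem_univ s),
      ← Finset.sum_erase (a := s) (f := fun y => if y = s then (0 : ℝ) else block χ y) Finset.univ
        (if_pos rfl)]
    refine Finset.sum_congr rfl fun y hy => ?_
    rw [if_neg (Finset.ne_of_mem_erase hy)]
  rw [e, matchWeight, Finset.sum_div, ← Finset.sum_add_distrib]
  refine Finset.sum_le_sum fun y _ => ?_
  have := hc0 i s y
  have := hcR i s y
  have := hb0 y
  split_ifs <;> linarith

/-- One copy of the clique squares is absorbed by `(∑ block)² - ∑ block²`, up to squares of cells.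
The other copy and those squares are linear in the weight, as cliques have at most `D * R` vertices
and cells at most `R`. -/
lemma sum_sq_block_le {χ : Vtx k D R M Z → ℝ} (h0 : ∀ v, 0 ≤ χ v) (h1 : ∀ v, χ v ≤ 1) :
    2 * ∑ i, ∑ x, (∑ y, cell χ i x y) ^ 2 + ∑ y, block χ y ^ 2 - (∑ y, block χ y) ^ 2
      ≤ (D * R + R) * ∑ y, block χ y := by
  have hc0 : ∀ i x y, 0 ≤ cell χ i x y := fun i x y => Finset.sum_nonneg fun r _ => h0 _
  have hcR : ∀ i x y, cell χ i x y ≤ R := fun i x y => by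
    simpa [cell] using Finset.sum_le_sum fun r (_ : r ∈ Finset.univ) => h1 (.inl (i, x, y, r))
  have hrow : ∀ i x, ∑ y, cell χ i x y ≤ D * R := fun i x => by
    simpa using Finset.sum_le_sum fun y (_ : y ∈ Finset.univ) => hcR i x y
  have htot : ∑ y, block χ y = ∑ i, ∑ x, ∑ y, cell χ i x y := by
    simp only [block]
    rw [Finset.sum_comm]
    exact Finset.sum_congr rfl fun i _ => Finset.sum_comm
  have hsq : ∑ i, ∑ x, (∑ y, cell χ i x y) ^ 2 ≤ D * R * ∑ y, block χ y := by
    rw [htot]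
    simp only [Finset.mul_sum (a := (D * R : ℝ))]
    refine Finset.sum_le_sum fun i _ => Finset.sum_le_sum fun x _ => ?_
    rw [← Finset.mul_sum, sq]
    exact mul_le_mul_of_nonneg_right (hrow i x) (Finset.sum_nonneg fun y _ => hc0 i x y)
  have hsq' : ∑ i, ∑ x, ∑ y, cell χ i x y ^ 2 ≤ R * ∑ y, block χ y := by
    rw [htot]
    simp only [Finset.mul_sum]
    refine Finset.sum_le_sum fun i _ => Finset.sum_le_sum fun x _ =>
      Finset.sum_le_sum fun y _ => ?_
    rw [sq]
    exact mul_le_mul_of_nonneg_right (hcR i x y) (hc0 i x y)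
  -- Products of different cells in one clique are among the products of different blocks.
  have hmain : ∑ i, ∑ x, ((∑ y, cell χ i x y) ^ 2 - ∑ y, cell χ i x y ^ 2)
      ≤ (∑ y, block χ y) ^ 2 - ∑ y, block χ y ^ 2 := by
    have e1 : (∑ y, block χ y) ^ 2 - ∑ y, block χ y ^ 2
        = ∑ i, ∑ x, ∑ y, cell χ i x y * (∑ y', block χ y' - block χ y) := by
      rw [sq, Finset.sum_mul, ← Finset.sum_sub_distrib]
      have : ∀ y, block χ y * ∑ y', block χ y' - block χ y ^ 2
          = ∑ i, ∑ x, cell χ i x y * (∑ y', block χ y' - block χ y) := by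
        intro y
        simp only [← Finset.sum_mul]
        rw [← block]
        ring
      rw [Finset.sum_congr rfl fun y _ => this y, Finset.sum_comm]
      exact Finset.sum_congr rfl fun i _ => Finset.sum_comm
    rw [e1]
    refine Finset.sum_le_sum fun i _ => Finset.sum_le_sum fun x _ => ?_
    rw [sq, Finset.sum_mul, ← Finset.sum_sub_distrib]
    refine Finset.sum_le_sum fun y _ => ?_
    rw [sq, ← mul_sub]
    refine mul_le_mul_of_nonneg_left ?_ (hc0 i x y)
    rw [← Finset.sum_erase_eq_sub (Finset.mem_univ y), ← Finset.sum_erase_eq_sub (Finset.mem_univ y)]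
    refine Finset.sum_le_sum fun y' _ => ?_
    have hx : cell χ i x y' ≤ ∑ x', cell χ i x' y' :=
      Finset.single_le_sum (fun x' _ => hc0 i x' y') (Finset.mem_univ x)
    exact hx.trans (Finset.single_le_sum (f := fun i' => ∑ x', cell χ i' x' y')
      (fun i' _ => Finset.sum_nonneg fun x' _ => hc0 i' x' y') (Finset.mem_univ i))
  simp only [Finset.sum_sub_distrib] at hmain
  linarith

/-- The gain of a cluster without its matching weight is bounded in terms of its size. -/
lemma sum_sgn_le {χ : Vtx k D R M Z → ℝ} (h0 : ∀ v, 0 ≤ χ v) (h1 : ∀ v, χ v ≤ 1) :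
    ∑ v, ∑ z, χ v * χ z * sgn σ v z
      ≤ (D * R + R) * ∑ u : Fin k × Fin D × Fin D × Fin R, χ (.inl u)
        + 4 * ∑ w, ∑ s, χ (.inr (.inl (w, s))) * matchWeight χ (σ w) s := by
  classical
  set a := ∑ y, block χ y with ha
  set b := ∑ p : Fin M × Fin D, χ (.inr (.inl p)) with hb
  set c := ∑ l : Fin Z, χ (.inr (.inr l)) with hc
  have ha' := sum_block χ
  have hb0 : 0 ≤ b := Finset.sum_nonneg fun p _ => h0 _
  have hc0 : 0 ≤ c := Finset.sum_nonneg fun p _ => h0 _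
  have ha0 : 0 ≤ a := by rw [ha, ha']; exact Finset.sum_nonneg fun p _ => h0 _
  have htot : ∑ v, χ v = a + (b + c) := by
    rw [Fintype.sum_sum_type, Fintype.sum_sum_type, ha, ha']
  have e1 : ∑ v, ∑ z, χ v * χ z * sgn σ v z
      = 2 * (∑ v, ∑ z, χ v * χ z * (if Adj σ v z then 1 else 0)) - (a + (b + c)) ^ 2 := by
    rw [← htot, sq, Finset.sum_mul_sum]
    simp only [Finset.mul_sum, ← Finset.sum_sub_distrib, sgn]
    refine Finset.sum_congr rfl fun v _ => Finset.sum_congr rfl fun z _ => ?_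
    ring
  have hUW : ∑ u, ∑ p, χ (.inl u) * χ (.inr (.inl p))
        * (if Adj (Z := Z) σ (.inl u) (.inr (.inl p)) then (1 : ℝ) else 0)
      ≤ ∑ w, ∑ s, χ (.inr (.inl (w, s)))
        * (block χ s + (matchWeight χ (σ w) s + (a - block χ s) / 2)) := by
    rw [Finset.sum_comm, Fintype.sum_prod_type]
    refine Finset.sum_le_sum fun w _ => Finset.sum_le_sum fun s _ => ?_
    have h := (sum_hidden_le σ h0 w s).trans (add_le_add_right (cell_le_add h0 h1 (σ w) s) _)
    refine le_trans (le_of_eq ?_) (mul_le_mul_of_nonneg_left h (h0 _))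
    rw [Finset.mul_sum]
    refine Finset.sum_congr rfl fun u _ => ?_
    ring
  have e2 : ∑ v, ∑ z, χ v * χ z * (if Adj σ v z then (1 : ℝ) else 0)
      = ∑ u, ∑ u', χ (.inl u) * χ (.inl u') * (if Adj (Z := Z) σ (.inl u) (.inl u') then (1 : ℝ) else 0)
        + 2 * ∑ u, ∑ p, χ (.inl u) * χ (.inr (.inl p))
        * (if Adj (Z := Z) σ (.inl u) (.inr (.inl p)) then (1 : ℝ) else 0) := by
    have hWU : ∑ p, ∑ u, χ (.inr (.inl p)) * χ (.inl u)
        * (if Adj (Z := Z) σ (.inr (.inl p)) (.inl u) then (1 : ℝ) else 0)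
        = ∑ u, ∑ p, χ (.inl u) * χ (.inr (.inl p))
        * (if Adj (Z := Z) σ (.inl u) (.inr (.inl p)) then (1 : ℝ) else 0) := by
      rw [Finset.sum_comm]
      refine Finset.sum_congr rfl fun u _ => Finset.sum_congr rfl fun p _ => ?_
      rw [mul_comm (χ (.inr (.inl p)))]
      rfl
    simp only [Fintype.sum_sum_type (α₁ := Fin k × Fin D × Fin D × Fin R),
      Fintype.sum_sum_type (α₁ := Fin M × Fin D), Finset.sum_add_distrib]
    rw [hWU]
    simp [Adj]
    ring
  have hbs : b = ∑ s, ∑ w, χ (.inr (.inl (w, s))) := by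
    rw [hb, Fintype.sum_prod_type, Finset.sum_comm]
  have hsplit : ∑ w, ∑ s, χ (.inr (.inl (w, s)))
        * (block χ s + (matchWeight χ (σ w) s + (a - block χ s) / 2))
      = ∑ w, ∑ s, χ (.inr (.inl (w, s))) * matchWeight χ (σ w) s
        + (∑ s, (∑ w, χ (.inr (.inl (w, s)))) * block χ s) / 2 + b * a / 2 := by
    have e3 : ∑ s, (∑ w, χ (.inr (.inl (w, s)))) * block χ s
        = ∑ w, ∑ s, χ (.inr (.inl (w, s))) * block χ s := by
      rw [Finset.sum_comm]
      simp only [Finset.sum_mul]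
    have e4 : b * a = ∑ w, ∑ s, χ (.inr (.inl (w, s))) * a := by
      rw [hb, Fintype.sum_prod_type]
      simp only [Finset.sum_mul]
    rw [e3, e4]
    simp only [Finset.sum_div, ← Finset.sum_add_distrib]
    refine Finset.sum_congr rfl fun w _ => Finset.sum_congr rfl fun s _ => ?_
    ring
  -- The unmatched edges between copies and blocks are paid for by the non-edges among the copies,
  -- `b ^ 2`, and by `∑ block²`, which `sum_sq_block_le` absorbs.
  have hamgm : 2 * ∑ s, (∑ w, χ (.inr (.inl (w, s)))) * block χ s
      ≤ b ^ 2 + ∑ s, block χ s ^ 2 := by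
    have hB : ∑ s, (∑ w, χ (.inr (.inl (w, s)))) ^ 2 ≤ b ^ 2 := by
      rw [hbs]
      exact Finset.sum_sq_le_sq_sum_of_nonneg fun s _ => Finset.sum_nonneg fun w _ => h0 _
    refine le_trans ?_ (add_le_add_left hB _)
    rw [Finset.mul_sum, ← Finset.sum_add_distrib]
    refine Finset.sum_le_sum fun s _ => ?_
    nlinarith [sq_nonneg (∑ w, χ (.inr (.inl (w, s))) - block χ s)]
  have hcl := sum_clique_le σ h0
  have hF := sum_sq_block_le h0 h1
  rw [← ha']
  rw [e1, e2]
  rw [hsplit] at hUW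
  -- Isolated vertices only lower the gain.
  have hsq : (a + b) ^ 2 ≤ (a + (b + c)) ^ 2 := by
    gcongr
    linarith
  nlinarith

end Quadratic

end Vtx

/-! ### From cost to gain. -/

section Gain

variable {n : ℕ}

lemma Clustering.same_iff (C : Clustering n) (u v : Fin n) : C.Same u v ↔ C.part u = C.part v := by
  rw [← C.mem_part_iff_part_eq_part (Finset.mem_univ u) (Finset.mem_univ v),
    Finpartition.mem_part_iff_exists]
  exact Iff.rfl

open Classical in
/-- The gain of a clustering: the number of ordered pairs in a common cluster, counted with sign `1`
if they are adjacent and `-1` otherwise. -/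
noncomputable def gain (G : SimpleGraph (Fin n)) (C : Clustering n) : ℝ :=
  ∑ u, ∑ v, if C.part u = C.part v then 2 * (if G.Adj u v then 1 else 0) - 1 else 0

open Classical in
lemma two_mul_card_lt {p : Fin n → Fin n → Prop}
    [DecidablePred fun q : Fin n × Fin n => q.1 < q.2 ∧ p q.1 q.2] (hp : ∀ u v, p u v → p v u) :
    2 * ((Finset.univ.filter fun q : Fin n × Fin n => q.1 < q.2 ∧ p q.1 q.2).card : ℝ)
      = ∑ u, ∑ v, if u ≠ v ∧ p u v then 1 else 0 := by
  have h1 : ((Finset.univ.filter fun q : Fin n × Fin n => q.1 < q.2 ∧ p q.1 q.2).card : ℝ)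
      = ∑ u, ∑ v, if u < v ∧ p u v then 1 else 0 := by
    rw [← Fintype.sum_prod_type' (f := fun u v => if u < v ∧ p u v then (1 : ℝ) else 0),
      Finset.natCast_card_filter]
    congr!
  rw [two_mul]
  nth_rewrite 2 [h1]
  rw [Finset.sum_comm, h1, ← Finset.sum_add_distrib]
  refine Finset.sum_congr rfl fun u _ => ?_
  rw [← Finset.sum_add_distrib]
  refine Finset.sum_congr rfl fun v _ => ?_
  have hs : p u v ↔ p v u := ⟨hp u v, hp v u⟩
  rcases lt_trichotomy u v with h | rfl | h
  · simp [h, h.ne, h.not_gt]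
  · simp
  · simp [h, h.ne', h.not_gt, hs]

-- Up to a factor `-2`, cost and gain differ by a quantity independent of `C`. The term `n` corrects
-- for the diagonal, where every vertex contributes `-1` to the gain.
open Classical in
lemma two_mul_cost (G : SimpleGraph (Fin n)) (C : Clustering n) :
    2 * (cost G C : ℝ) = (∑ u, ∑ v, if G.Adj u v then 1 else 0) - n - gain G C := by
  have hs : ∀ u v, C.Same u v → C.Same v u := fun u v h => by
    rw [Clustering.same_iff] at h ⊢
    exact h.symm
  rw [cost, Nat.cast_add, mul_add,
    two_mul_card_lt (p := fun u v => ¬ G.Adj u v ∧ C.Same u v)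
      (fun u v h => ⟨fun h' => h.1 h'.symm, hs u v h.2⟩),
    two_mul_card_lt (p := fun u v => G.Adj u v ∧ ¬ C.Same u v)
      (fun u v h => ⟨h.1.symm, fun h' => h.2 (hs v u h')⟩)]
  have hn : (n : ℝ) = ∑ u : Fin n, ∑ v, if u = v then (1 : ℝ) else 0 := by simp
  rw [hn, gain]
  simp only [← Finset.sum_add_distrib, ← Finset.sum_sub_distrib]
  refine Finset.sum_congr rfl fun u _ => Finset.sum_congr rfl fun v _ => ?_
  rw [Clustering.same_iff]
  rcases eq_or_ne u v with rfl | huv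
  · simp
  · by_cases h1 : G.Adj u v <;> by_cases h2 : C.part u = C.part v <;>
      simp [huv, h1, h2]
    norm_num

lemma IsApprox.gain_le {G : SimpleGraph (Fin n)} {δ : ℝ} {C : Clustering n} (h : IsApprox G δ C)
    (C' : Clustering n) : gain G C' ≤ gain G C + 2 * δ := by
  have := h C'
  have := two_mul_cost G C
  have := two_mul_cost G C'
  linarith

end Gain

/-! ### Gains in the hard graph: arbitrary clusterings against the planted one. -/

section HardGain

variable {k D R M Z n : ℕ} (e : Fin n ≃ Vtx k D R M Z)

open Classical in
/-- The indicator of a set of vertices. -/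
noncomputable def clusterInd (C : Clustering n) (P : Finset (Fin n)) (v : Vtx k D R M Z) : ℝ :=
  if C.part (e.symm v) = P then 1 else 0

lemma clusterInd_nonneg (C : Clustering n) (P : Finset (Fin n)) (v : Vtx k D R M Z) :
    0 ≤ clusterInd e C P v := by
  unfold clusterInd
  split_ifs <;> norm_num

lemma clusterInd_le_one (C : Clustering n) (P : Finset (Fin n)) (v : Vtx k D R M Z) :
    clusterInd e C P v ≤ 1 := by
  unfold clusterInd
  split_ifs <;> norm_num

/-- The number of vertices with label `i` that the clusters of the copies of `w` contain, where
large blocks are left out. -/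
noncomputable def score (C : Clustering n) (w : Fin M) (i : Fin k) : ℝ :=
  ∑ s, Vtx.matchWeight (clusterInd e C (C.part (e.symm (.inr (.inl (w, s)))))) i s

lemma Vtx.cell_nonneg {χ : Vtx k D R M Z → ℝ} (h0 : ∀ v, 0 ≤ χ v) (i : Fin k) (x y : Fin D) :
    0 ≤ cell χ i x y := Finset.sum_nonneg fun _ _ => h0 _

lemma Vtx.cell_le {χ : Vtx k D R M Z → ℝ} (h1 : ∀ v, χ v ≤ 1) (i : Fin k) (x y : Fin D) :
    cell χ i x y ≤ R := by
  simpa [cell] using Finset.sum_le_sum fun r (_ : r ∈ Finset.univ) => h1 (.inl (i, x, y, r))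

lemma score_nonneg (C : Clustering n) (w : Fin M) (i : Fin k) : 0 ≤ score e C w i := by
  refine Finset.sum_nonneg fun s _ => Finset.sum_nonneg fun y _ => ?_
  split_ifs
  · exact Vtx.cell_nonneg (clusterInd_nonneg e C _) _ _ _
  · exact le_rfl

lemma score_le (C : Clustering n) (w : Fin M) (i : Fin k) : score e C w i ≤ D * (D * R) := by
  have h : ∀ s : Fin D, Vtx.matchWeight
      (clusterInd e C (C.part (e.symm (.inr (.inl (w, s)))))) i s ≤ D * R := by
    intro s
    have h' : ∀ y : Fin D, (if Vtx.block
        (clusterInd e C (C.part (e.symm (.inr (.inl (w, s)))))) y ≤ 2 * R then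
          Vtx.cell (clusterInd e C (C.part (e.symm (.inr (.inl (w, s)))))) i s y else 0)
          ≤ (R : ℝ) := by
      intro y
      split_ifs
      · exact Vtx.cell_le (clusterInd_le_one e C _) _ _ _
      · positivity
    simpa [Vtx.matchWeight] using Finset.sum_le_sum fun y (_ : y ∈ Finset.univ) => h' y
  simpa [score] using Finset.sum_le_sum fun s (_ : s ∈ Finset.univ) => h s

/-- This is why large blocks are left out: each small block has at most `2 * R` vertices to share
among all labels, so one huge cluster cannot match every label at once. -/
lemma sum_score_label_le (C : Clustering n) (w : Fin M) :
    ∑ i, score e C w i ≤ D * (D * (2 * R)) := by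
  simp only [score, Vtx.matchWeight]
  rw [Finset.sum_comm]
  have h : ∀ s y : Fin D, ∑ i : Fin k, (if Vtx.block
        (clusterInd e C (C.part (e.symm (.inr (.inl (w, s)))))) y ≤ 2 * R then
          Vtx.cell (clusterInd e C (C.part (e.symm (.inr (.inl (w, s)))))) i s y else 0)
          ≤ (2 * R : ℝ) := by
    intro s y
    split_ifs with hb
    · refine le_trans ?_ hb
      refine Finset.sum_le_sum fun i _ => ?_
      exact Finset.single_le_sum
        (fun x _ => Vtx.cell_nonneg (clusterInd_nonneg e C _) i x y) (Finset.mem_univ s)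
    · simp
  have h' : ∀ s : Fin D, ∑ i : Fin k, ∑ y, (if Vtx.block
        (clusterInd e C (C.part (e.symm (.inr (.inl (w, s)))))) y ≤ 2 * R then
          Vtx.cell (clusterInd e C (C.part (e.symm (.inr (.inl (w, s)))))) i s y else 0)
          ≤ (D * (2 * R) : ℝ) := by
    intro s
    rw [Finset.sum_comm]
    simpa using Finset.sum_le_sum fun y (_ : y ∈ Finset.univ) => h s y
  simpa using Finset.sum_le_sum fun s (_ : s ∈ Finset.univ) => h' s

open Classical in
lemma gain_hardGraph (σ : Fin M → Fin k) (C : Clustering n) :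
    gain (hardGraph e σ) C
      = ∑ v, ∑ z, if C.part (e.symm v) = C.part (e.symm z) then Vtx.sgn σ v z else 0 := by
  rw [gain, ← e.symm.sum_comp]
  refine Finset.sum_congr rfl fun v _ => ?_
  rw [← e.symm.sum_comp]
  refine Finset.sum_congr rfl fun z _ => ?_
  have h : (hardGraph e σ).Adj (e.symm v) (e.symm z) ↔ Vtx.Adj σ v z := by
    change Vtx.Adj σ (e (e.symm v)) (e (e.symm z)) ↔ _
    rw [e.apply_symm_apply, e.apply_symm_apply]
  simp only [Vtx.sgn, h]

/-- Without the score, the gain is far below the optimum. -/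
lemma gain_le_score (σ : Fin M → Fin k) (C : Clustering n) :
    gain (hardGraph e σ) C
      ≤ (D * R + R) * (k * (D * (D * R))) + 4 * ∑ w, score e C w (σ w) := by
  classical
  have hP : ∀ (f : Finset (Fin n) → ℝ) v, ∑ P, clusterInd e C P v * f P
      = f (C.part (e.symm v)) := by
    intro f v
    simp [clusterInd]
  have h1 : gain (hardGraph e σ) C
      = ∑ P, ∑ v, ∑ z, clusterInd e C P v * clusterInd e C P z * Vtx.sgn σ v z := by
    rw [gain_hardGraph]
    symm
    rw [Finset.sum_comm]
    refine Finset.sum_congr rfl fun v _ => ?_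
    rw [Finset.sum_comm]
    refine Finset.sum_congr rfl fun z _ => ?_
    simp only [mul_assoc]
    rw [hP (fun P => clusterInd e C P z * Vtx.sgn σ v z)]
    simp [clusterInd, eq_comm]
  rw [h1]
  refine le_trans (Finset.sum_le_sum fun P _ => Vtx.sum_sgn_le σ (clusterInd_nonneg e C P)
    (clusterInd_le_one e C P)) (le_of_eq ?_)
  rw [Finset.sum_add_distrib, ← Finset.mul_sum, ← Finset.mul_sum]
  congr 2
  · rw [Finset.sum_comm]
    have h2 : ∀ u : Fin k × Fin D × Fin D × Fin R, ∑ P, clusterInd e C P (.inl u) = 1 := by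
      intro u
      simp [clusterInd]
    simp only [h2]
    simp
  · rw [Finset.sum_comm]
    refine Finset.sum_congr rfl fun w _ => ?_
    rw [Finset.sum_comm]
    refine Finset.sum_congr rfl fun s _ => ?_
    exact hP (fun P => Vtx.matchWeight (clusterInd e C P) (σ w) s) _

/-- The cluster of a vertex in the planted clustering. -/
def plantedLabel (σ : Fin M → Fin k) : Vtx k D R M Z → (Fin k × Fin D) ⊕ Fin Z
  | .inl (i, x, _, _) => .inl (i, x)
  | .inr (.inl (w, s)) => .inl (σ w, s)
  | .inr (.inr l) => .inr l

open Classical in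
/-- The planted clustering. -/
noncomputable def planted (σ : Fin M → Fin k) : Clustering n :=
  Finpartition.ofSetoid (Setoid.ker fun v => plantedLabel σ (e v))

open Classical in
lemma part_planted_eq_iff (σ : Fin M → Fin k) (u v : Fin n) :
    (planted e σ).part u = (planted e σ).part v
      ↔ plantedLabel σ (e u) = plantedLabel σ (e v) := by
  rw [← (planted e σ).mem_part_iff_part_eq_part (Finset.mem_univ u) (Finset.mem_univ v), planted,
    Finpartition.mem_part_ofSetoid_iff_rel]
  exact eq_comm

open Classical in
/-- The number of ordered pairs of hidden vertices with the same label. -/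
noncomputable def collisions (σ : Fin M → Fin k) : ℝ := ∑ w, ∑ w', if σ w = σ w' then 1 else 0

-- The terms come from the cliques (with `-2` for the diagonal), the fully joined copies in both
-- orders, the pairs of copies in one cluster, which are never adjacent, and the isolated
-- singletons.
open Classical in
lemma le_gain_planted (σ : Fin M → Fin k) :
    k * (D * (D * R)) * ((D * R) - 2) + 2 * (M * D * (D * R)) - D * collisions σ - Z
      ≤ gain (hardGraph e σ) (planted e σ) := by
  rw [gain_hardGraph]
  simp only [part_planted_eq_iff, e.apply_symm_apply]
  simp only [Fintype.sum_sum_type (α₁ := Fin k × Fin D × Fin D × Fin R),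
      Fintype.sum_sum_type (α₁ := Fin M × Fin D), Finset.sum_add_distrib]
  have hUU : ∑ u : Fin k × Fin D × Fin D × Fin R, ∑ u' : Fin k × Fin D × Fin D × Fin R,
      (if plantedLabel σ (.inl u : Vtx k D R M Z) = plantedLabel σ (.inl u' : Vtx k D R M Z)
        then Vtx.sgn σ (.inl u : Vtx k D R M Z) (.inl u') else 0)
      = k * (D * (D * R)) * ((D * R) - 2) := by
    have h : ∀ u u' : Fin k × Fin D × Fin D × Fin R,
      (if plantedLabel σ (.inl u : Vtx k D R M Z) = plantedLabel σ (.inl u' : Vtx k D R M Z)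
        then Vtx.sgn σ (.inl u : Vtx k D R M Z) (.inl u') else 0)
      = (if u.1 = u'.1 then (if u.2.1 = u'.2.1 then (1 : ℝ) else 0) else 0)
        - 2 * (if u = u' then (1 : ℝ) else 0) := by
      rintro ⟨i, x, y, r⟩ ⟨i', x', y', r'⟩
      by_cases hi : i = i' <;> by_cases hx : x = x' <;> by_cases hy : y = y' <;>
        by_cases hr : r = r' <;> simp [plantedLabel, Vtx.sgn, Vtx.Adj, hi, hx, hy, hr] <;> norm_num
    have h' : ∀ u : Fin k × Fin D × Fin D × Fin R, ∑ u' : Fin k × Fin D × Fin D × Fin R,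
        (if u.1 = u'.1 then (if u.2.1 = u'.2.1 then (1 : ℝ) else 0) else 0) = D * R := by
      intro u
      rw [Fintype.sum_prod_type]
      simp only [Finset.sum_ite_irrel, Finset.sum_const_zero, Finset.sum_ite_eq, Finset.mem_univ,
        if_true, Fintype.sum_prod_type]
      rw [Finset.sum_eq_single_of_mem u.2.1 (Finset.mem_univ _) fun x _ h => by simp [h.symm]]
      simp
    simp only [h, Finset.sum_sub_distrib, h', ← Finset.mul_sum]
    simp
    ring
  have hUW : ∑ u : Fin k × Fin D × Fin D × Fin R, ∑ p : Fin M × Fin D,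
      (if plantedLabel σ (.inl u : Vtx k D R M Z) = plantedLabel σ (.inr (.inl p) : Vtx k D R M Z)
        then Vtx.sgn σ (.inl u : Vtx k D R M Z) (.inr (.inl p)) else 0)
      = M * D * (D * R) := by
    have h : ∀ (u : Fin k × Fin D × Fin D × Fin R) (p : Fin M × Fin D),
      (if plantedLabel σ (.inl u : Vtx k D R M Z) = plantedLabel σ (.inr (.inl p) : Vtx k D R M Z)
        then Vtx.sgn σ (.inl u : Vtx k D R M Z) (.inr (.inl p)) else 0)
      = if u.1 = σ p.1 then (if u.2.1 = p.2 then (1 : ℝ) else 0) else 0 := by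
      rintro ⟨i, x, y, r⟩ ⟨w, s⟩
      by_cases hi : i = σ w <;> by_cases hx : x = s <;>
        simp [plantedLabel, Vtx.sgn, Vtx.Adj, hi, hx]
      norm_num
    rw [Finset.sum_comm]
    have h' : ∀ p : Fin M × Fin D, ∑ u : Fin k × Fin D × Fin D × Fin R,
        (if u.1 = σ p.1 then (if u.2.1 = p.2 then (1 : ℝ) else 0) else 0) = D * R := by
      intro p
      rw [Fintype.sum_prod_type]
      simp only [Finset.sum_ite_irrel, Finset.sum_const_zero, Finset.sum_ite_eq', Finset.mem_univ,
        if_true, Fintype.sum_prod_type]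
      rw [Finset.sum_eq_single_of_mem p.2 (Finset.mem_univ _) fun x _ h => by simp [h]]
      simp
    simp only [h, h']
    simp
  have hWU : ∑ p : Fin M × Fin D, ∑ u : Fin k × Fin D × Fin D × Fin R,
      (if plantedLabel σ (.inr (.inl p) : Vtx k D R M Z) = plantedLabel σ (.inl u : Vtx k D R M Z)
        then Vtx.sgn σ (.inr (.inl p) : Vtx k D R M Z) (.inl u) else 0)
      = M * D * (D * R) := by
    rw [← hUW, Finset.sum_comm]
    refine Finset.sum_congr rfl fun u _ => Finset.sum_congr rfl fun p _ => ?_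
    exact if_congr eq_comm rfl rfl
  have hWW : ∑ p : Fin M × Fin D, ∑ p' : Fin M × Fin D,
      (if plantedLabel σ (.inr (.inl p) : Vtx k D R M Z)
          = plantedLabel σ (.inr (.inl p') : Vtx k D R M Z)
        then Vtx.sgn σ (.inr (.inl p) : Vtx k D R M Z) (.inr (.inl p')) else 0)
      = - (D * collisions σ) := by
    have h : ∀ p p' : Fin M × Fin D,
      (if plantedLabel σ (.inr (.inl p) : Vtx k D R M Z)
          = plantedLabel σ (.inr (.inl p') : Vtx k D R M Z)
        then Vtx.sgn σ (.inr (.inl p) : Vtx k D R M Z) (.inr (.inl p')) else 0)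
      = - (if p.2 = p'.2 then (if σ p.1 = σ p'.1 then (1 : ℝ) else 0) else 0) := by
      rintro ⟨w, s⟩ ⟨w', s'⟩
      by_cases hi : σ w = σ w' <;> by_cases hx : s = s' <;>
        simp [plantedLabel, Vtx.sgn, Vtx.Adj, hi, hx]
    simp only [h, Finset.sum_neg_distrib, Fintype.sum_prod_type, Finset.sum_ite_eq,
      Finset.mem_univ, if_true, collisions]
    rw [Finset.sum_comm]
    simp
  rw [hUU, hUW, hWU, hWW]
  have hZ : ∑ l : Fin Z, ∑ l' : Fin Z,
      (if plantedLabel σ (.inr (.inr l) : Vtx k D R M Z)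
          = plantedLabel σ (.inr (.inr l') : Vtx k D R M Z)
        then Vtx.sgn σ (.inr (.inr l) : Vtx k D R M Z) (.inr (.inr l')) else 0) = - (Z : ℝ) := by
    simp [plantedLabel, Vtx.sgn, Vtx.Adj]
  rw [hZ]
  simp [plantedLabel]
  linarith

end HardGain

/-! ### Collisions of random labels. -/

section Collisions

variable {k M : ℕ}

lemma sq_le_mul_collisions (σ : Fin M → Fin k) : (M : ℝ) ^ 2 ≤ k * collisions σ := by
  classical
  have h1 : ∑ i, ∑ w, (if σ w = i then (1 : ℝ) else 0) = M := by
    rw [Finset.sum_comm]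
    simp
  have h2 : collisions σ = ∑ i, (∑ w, if σ w = i then (1 : ℝ) else 0) ^ 2 := by
    simp only [sq, Finset.sum_mul_sum, collisions]
    symm
    rw [Finset.sum_comm]
    refine Finset.sum_congr rfl fun w _ => ?_
    rw [Finset.sum_comm]
    refine Finset.sum_congr rfl fun w' _ => ?_
    simp [eq_comm]
  have h := sq_sum_le_card_mul_sum_sq (s := Finset.univ)
    (f := fun i => ∑ w, if σ w = i then (1 : ℝ) else 0)
  rwa [h1, ← h2, Finset.card_univ, Fintype.card_fin] at h

/-- Overwriting `σ w` loses nothing when `σ w = σ w'`, since the value can be read off at `w'`. -/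
lemma mul_card_eq_le {w w' : Fin M} (h : w ≠ w') :
    k * (Finset.univ.filter fun σ : Fin M → Fin k => σ w = σ w').card
      ≤ Fintype.card (Fin M → Fin k) := by
  have hc := Finset.card_product (Finset.univ : Finset (Fin k))
    (Finset.univ.filter fun σ : Fin M → Fin k => σ w = σ w')
  rw [Finset.card_univ, Fintype.card_fin] at hc
  rw [← hc, ← Finset.card_univ]
  refine Finset.card_le_card_of_injOn (t := Finset.univ)
    (fun p => Function.update p.2 w p.1) (fun _ _ => Finset.mem_univ _) ?_
  rintro ⟨i, σ⟩ hσ ⟨j, τ⟩ hτ heq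
  simp only [Finset.coe_product, Finset.coe_univ, Finset.coe_filter, Finset.mem_univ, true_and,
    Set.mem_prod, Set.mem_univ, Set.mem_ofPred_eq] at hσ hτ heq
  have hv : ∀ v, v ≠ w → σ v = τ v := fun v hv => by
    simpa [hv] using congrFun heq v
  have hij : i = j := by simpa using congrFun heq w
  refine Prod.ext hij (funext fun v => ?_)
  rcases eq_or_ne v w with rfl | hvw
  · exact hσ.trans ((hv w' h.symm).trans hτ.symm)
  · exact hv v hvw

lemma sum_collisions_le (hk : 0 < k) :
    ∑ σ : Fin M → Fin k, collisions σ
      ≤ Fintype.card (Fin M → Fin k) * (M + (M : ℝ) ^ 2 / k) := by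
  classical
  have hk' : (0 : ℝ) < k := by exact_mod_cast hk
  set N : ℝ := (Fintype.card (Fin M → Fin k) : ℝ) with hN
  have hpair : ∀ w w' : Fin M, ∑ σ : Fin M → Fin k, (if σ w = σ w' then (1 : ℝ) else 0)
      ≤ N * (if w = w' then 1 else 0) + N / k := by
    intro w w'
    rcases eq_or_ne w w' with rfl | h
    · simp only [if_true, Finset.sum_const, Finset.card_univ, nsmul_eq_mul, mul_one, ← hN]
      have : 0 ≤ N / k := by positivity
      linarith
    · rw [if_neg h, mul_zero, zero_add, Finset.sum_boole, le_div_iff₀ hk', mul_comm, hN]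
      exact_mod_cast mul_card_eq_le (k := k) h
  simp only [collisions]
  rw [Finset.sum_comm]
  refine (Finset.sum_le_sum fun w _ => Finset.sum_comm.le.trans
    (Finset.sum_le_sum fun w' _ => hpair w w')).trans (le_of_eq ?_)
  simp [Finset.sum_add_distrib]
  ring

end Collisions

/-! ### Few queries fail for most labels. -/

section Counting

variable {k R Z n : ℕ} (e : Fin n ≃ Vtx k 2 R (k * (2 * R)) Z)

/-- With `D = 2` and `k * (2 * R)` labels, the planted gain is about `4 k (2R)²` and the score-free
bound is `3 k (2R)²`. The excess of collisions over their minimum stays as an error term. -/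
lemma IsApprox.le_score {δ : ℝ} {σ : Fin (k * (2 * R)) → Fin k} {C : Clustering n}
    (h : IsApprox (hardGraph e σ) δ C) :
    k * (2 * R) ^ 2 - 4 * k * (2 * R) - Z - 2 * δ
      ≤ 4 * ∑ w, score e C w (σ w) + 2 * (collisions σ - k * (2 * R) ^ 2) := by
  have h1 := le_gain_planted e σ
  have h2 := h.gain_le (planted e σ)
  have h3 := gain_le_score e σ C
  push_cast at h1 h3
  nlinarith

open Classical in
/-- A decision tree with few questions fails for most labels. -/
lemma card_isApprox_le (hk : 0 < k) (hR : 0 < R) {δ q : ℝ}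
    (hpos : 0 < k * (2 * R : ℝ) ^ 2 - 4 * k * (2 * R) - Z - 2 * δ)
    (hnum : 32 * (2 * R : ℝ) ^ 2 + 32 * (2 * R) * q / k + 2 * k * (2 * R)
      ≤ (k * (2 * R : ℝ) ^ 2 - 4 * k * (2 * R) - Z - 2 * δ) / 4)
    (T : DecTree (Fin (k * (2 * R))) (Fin k) (Clustering n))
    (hq : ∀ σ, (T.numAsk σ : ℝ) ≤ q) :
    4 * (Finset.univ.filter fun σ => IsApprox (hardGraph e σ) δ (T.eval σ)).card
      ≤ Fintype.card (Fin (k * (2 * R)) → Fin k) := by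
  have hk' : (0 : ℝ) < k := by exact_mod_cast hk
  have hR' : (0 : ℝ) < R := by exact_mod_cast hR
  set N : ℕ := Fintype.card (Fin (k * (2 * R)) → Fin k)
  set B : ℝ := k * (2 * R : ℝ) ^ 2 - 4 * k * (2 * R) - Z - 2 * δ
  -- By Cauchy–Schwarz the error term is nonnegative, as Markov's inequality requires.
  have hcoll : ∀ σ : Fin (k * (2 * R)) → Fin k, 0 ≤ collisions σ - k * (2 * R : ℝ) ^ 2 := by
    intro σ
    have h := sq_le_mul_collisions σ
    push_cast at h
    have h' : (k : ℝ) * (k * (2 * R) ^ 2) ≤ k * collisions σ := by nlinarith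
    linarith [le_of_mul_le_mul_left h' hk']
  -- For `D = 2` a score is at most `4 * R` and the scores of all labels sum to at most `8 * R`;
  -- dividing by `4 * R` gives total mass `A = 2`.
  have hscore := DecTree.sum_score_le (A := 2) zero_le_two
    (g := fun C w i => score e C w i / (2 * (2 * R : ℝ)))
    (fun C w i => div_nonneg (score_nonneg e C w i) (by positivity))
    (fun C w i => (div_le_one (by positivity)).2 (by simpa using score_le e C w i))
    (fun C w => by
      rw [← Finset.sum_div, div_le_iff₀ (by positivity)]
      have := sum_score_label_le e C w
      push_cast at this
      linarith) T hq
  simp only [Fintype.card_fin] at hscore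
  simp only [← Finset.sum_div] at hscore
  rw [div_le_iff₀ (by positivity)] at hscore
  have hsum := sum_collisions_le (M := k * (2 * R)) hk
  have hmarkov : ((Finset.univ.filter fun σ => IsApprox (hardGraph e σ) δ (T.eval σ)).card : ℝ) * B
      ≤ ∑ σ, (4 * ∑ w, score e (T.eval σ) w (σ w)
        + 2 * (collisions σ - k * (2 * R : ℝ) ^ 2)) := by
    rw [← nsmul_eq_mul, ← Finset.sum_const]
    refine (Finset.sum_le_sum fun σ hσ => ((Finset.mem_filter.1 hσ).2).le_score e).trans ?_
    refine Finset.sum_le_univ_sum_of_nonneg fun σ => ?_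
    have := hcoll σ
    have := Finset.sum_nonneg fun w (_ : w ∈ Finset.univ) =>
      score_nonneg e (T.eval σ) w (σ w)
    linarith
  rw [Finset.sum_add_distrib, ← Finset.mul_sum, ← Finset.mul_sum, Finset.sum_sub_distrib,
    Finset.sum_const, Finset.card_univ, nsmul_eq_mul] at hmarkov
  have hfin : ((Finset.univ.filter fun σ => IsApprox (hardGraph e σ) δ (T.eval σ)).card : ℝ) * B
      ≤ N * (B / 4) := by
    have h4 : 4 * ∑ σ : Fin (k * (2 * R)) → Fin k, ∑ w, score e (T.eval σ) w (σ w)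
        ≤ N * (32 * (2 * R : ℝ) ^ 2 + 32 * (2 * R) * q / k) := by
      refine (mul_le_mul_of_nonneg_left hscore (by norm_num : (0 : ℝ) ≤ 4)).trans (le_of_eq ?_)
      push_cast
      field_simp
      ring
    have h5 : 2 * (∑ σ : Fin (k * (2 * R)) → Fin k, collisions σ - N * (k * (2 * R : ℝ) ^ 2))
        ≤ N * (2 * k * (2 * R)) := by
      have e1 : (N : ℝ) * (((k * (2 * R) : ℕ) : ℝ) + ((k * (2 * R) : ℕ) : ℝ) ^ 2 / k)
          = N * (k * (2 * R)) + N * (k * (2 * R) ^ 2) := by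
        push_cast
        field_simp
      rw [e1] at hsum
      linarith
    refine hmarkov.trans ((add_le_add h4 h5).trans ?_)
    rw [← mul_add]
    gcongr
  have : (4 * (Finset.univ.filter fun σ => IsApprox (hardGraph e σ) δ (T.eval σ)).card : ℝ)
      ≤ N := by
    refine le_of_mul_le_mul_right (a := B) ?_ hpos
    linarith
  exact_mod_cast this

open Classical in
lemma outputDist_hardGraph {δ : ℝ} (A : RandQueryAlg n) (σ : Fin (k * (2 * R)) → Fin k) :
    (A.outputDist (hardGraph e σ)).toOuterMeasure {C | IsApprox (hardGraph e σ) δ C}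
      = ∑' T, A T * (((Finset.univ.filter fun L : NbrOrder (refGraph e) =>
          IsApprox (hardGraph e σ) δ ((T.toDecTree e L).eval σ)).card : ℝ≥0∞)
          / (Fintype.card (NbrOrder (refGraph e)) : ℝ≥0∞)) := by
  rw [RandQueryAlg.outputDist, PMF.toOuterMeasure_bind_apply]
  refine tsum_congr fun T => ?_
  rw [PMF.toOuterMeasure_map_apply, PMF.toOuterMeasure_uniformOfFintype_apply,
    ← Fintype.card_congr (orderEquiv e σ)]
  congr 3
  rw [← Fintype.card_subtype]
  refine Fintype.card_congr ((orderEquiv e σ).subtypeEquiv fun L => ?_).symm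
  rw [QueryAlg.eval_toDecTree]
  rfl

/-- A randomized algorithm with few queries does not solve the problem. -/
lemma not_solves (e : Fin n ≃ Vtx k 2 R (k * (2 * R)) Z) (hk : 0 < k) (hR : 0 < R) {δ q : ℝ}
    (hpos : 0 < k * (2 * R : ℝ) ^ 2 - 4 * k * (2 * R) - Z - 2 * δ)
    (hnum : 32 * (2 * R : ℝ) ^ 2 + 32 * (2 * R) * q / k + 2 * k * (2 * R)
      ≤ (k * (2 * R : ℝ) ^ 2 - 4 * k * (2 * R) - Z - 2 * δ) / 4)
    (A : RandQueryAlg n)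
    (hq : ∀ T ∈ A.support, ∀ (G : SimpleGraph (Fin n)) (L : NbrOrder G),
      (T.numQueries G L : ℝ) ≤ q) :
    ¬ A.Solves δ (1 / 3) := by
  classical
  intro hA
  have : Nonempty (Fin k) := ⟨⟨0, hk⟩⟩
  set Λ := NbrOrder (refGraph e)
  set N : ℕ := Fintype.card (Fin (k * (2 * R)) → Fin k) with hN
  have hN0 : 0 < N := Fintype.card_pos
  have hsum : (N : ℝ≥0∞) * (1 / 3) ≤ ∑ σ : Fin (k * (2 * R)) → Fin k,
      (A.outputDist (hardGraph e σ)).toOuterMeasure {C | IsApprox (hardGraph e σ) δ C} := by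
    rw [hN, ← Finset.card_univ, ← nsmul_eq_mul, ← Finset.sum_const]
    exact Finset.sum_le_sum fun σ _ => hA (hardGraph e σ)
  simp only [outputDist_hardGraph] at hsum
  rw [← Summable.tsum_finsetSum fun _ _ => ENNReal.summable] at hsum
  have hT : ∀ T : QueryAlg n, ∑ σ : Fin (k * (2 * R)) → Fin k,
      A T * (((Finset.univ.filter fun L : Λ =>
          IsApprox (hardGraph e σ) δ ((T.toDecTree e L).eval σ)).card : ℝ≥0∞)
          / (Fintype.card Λ : ℝ≥0∞)) ≤ A T * (N / 4) := by
    intro T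
    by_cases hs : T ∈ A.support
    · rw [← Finset.mul_sum]
      gcongr
      simp only [div_eq_mul_inv]
      rw [← Finset.sum_mul, ← div_eq_mul_inv, ← div_eq_mul_inv]
      refine ENNReal.div_le_of_le_mul ?_
      -- The bound on labels holds for each fixed reference order `L`, so the average over `σ` is
      -- taken inside.
      have hswap : ∑ σ : Fin (k * (2 * R)) → Fin k, (Finset.univ.filter fun L : Λ =>
          IsApprox (hardGraph e σ) δ ((T.toDecTree e L).eval σ)).card
          = ∑ L : Λ, (Finset.univ.filter fun σ =>
            IsApprox (hardGraph e σ) δ ((T.toDecTree e L).eval σ)).card := by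
        simp only [Finset.card_filter]
        exact Finset.sum_comm
      have hle : 4 * ∑ L : Λ, (Finset.univ.filter fun σ =>
            IsApprox (hardGraph e σ) δ ((T.toDecTree e L).eval σ)).card
          ≤ Fintype.card Λ * N := by
        rw [Finset.mul_sum]
        refine (Finset.sum_le_card_nsmul _ _ N fun L _ => ?_).trans_eq (smul_eq_mul _ _)
        refine card_isApprox_le e hk hR hpos hnum _ fun σ => ?_
        refine le_trans ?_ (hq T hs (hardGraph e σ) (orderEquiv e σ L))
        exact_mod_cast T.numAsk_toDecTree_le e L σ
      rw [← Nat.cast_sum, hswap, ← ENNReal.mul_div_right_comm,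
        ENNReal.le_div_iff_mul_le (Or.inl (by norm_num)) (Or.inl (by norm_num)),
        mul_comm, mul_comm (N : ℝ≥0∞)]
      exact_mod_cast hle
    · rw [PMF.mem_support_iff, not_not] at hs
      simp [hs]
  have hle := hsum.trans (ENNReal.tsum_le_tsum hT)
  rw [ENNReal.tsum_mul_right, A.tsum_coe, one_mul] at hle
  have h' := ENNReal.toReal_mono (by finiteness) hle
  rw [ENNReal.toReal_mul, ENNReal.toReal_div, ENNReal.toReal_div] at h'
  simp only [ENNReal.toReal_natCast, ENNReal.toReal_ofNat, ENNReal.toReal_one] at h'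
  have hN1 : (0 : ℝ) < N := by exact_mod_cast hN0
  linarith

end Counting

end CorrClust

/-! ### Choice of the parameters. -/

theorem theorem5p1 :
    ∃ c : ℝ, 0 < c ∧ ∀ ε : ℕ → ℝ,
      Tendsto (fun n : ℕ => ε n / (Real.log n / n)) atTop atTop →
      (∀ n, ε n < 1 / 10 ^ 6) →
      ∀ᶠ n : ℕ in atTop, ∀ A : CorrClust.RandQueryAlg n,
        A.Solves (ε n * (n : ℝ) ^ 2) (1 / 3) →
        ENNReal.ofReal (c * (n / ε n)) ≤ (A.worstCaseQueries : ℝ≥0∞) := by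
  refine ⟨1 / 10 ^ 7, by norm_num, fun ε hε hε1 => ?_⟩
  filter_upwards [hε.eventually_ge_atTop 1, eventually_ge_atTop 3] with n hn1 hn3 A hA
  have hn0 : (0 : ℝ) < n := by exact_mod_cast (by omega : 0 < n)
  have hlog : 1 ≤ Real.log n := by
    rw [Real.le_log_iff_exp_le hn0]
    have h3 : (3 : ℝ) ≤ n := by exact_mod_cast hn3
    linarith [Real.exp_one_lt_d9]
  have hεn : 1 ≤ ε n * n := by
    rw [le_div_iff₀ (by positivity), one_mul, div_le_iff₀ hn0] at hn1
    linarith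
  set x := ε n with hx
  have hx0 : 0 < x := by
    by_contra hcon
    nlinarith
  have hx1 : x < 1 / 10 ^ 6 := hε1 n
  -- The factor `512` makes the allowed error at most `k * R ^ 2 / 2` once `n ≤ 16 * (k * R)`; and
  -- `x < 1 / 10 ^ 6` gives `k > 10 ^ 6 / 512 - 1 > 1900`.
  obtain ⟨k, hk1, hk2, hk3⟩ : ∃ k : ℕ, 512 * x * k ≤ 1 ∧ 1 ≤ 1024 * x * k ∧ 1900 ≤ (k : ℝ) := by
    refine ⟨⌊1 / (512 * x)⌋₊, ?_⟩
    have h1 := Nat.floor_le (a := 1 / (512 * x)) (by positivity)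
    have h2 := Nat.lt_floor_add_one (1 / (512 * x))
    rw [le_div_iff₀ (by positivity)] at h1
    rw [div_lt_iff₀ (by positivity)] at h2
    refine ⟨by linarith, ?_, ?_⟩ <;> nlinarith
  have hk0 : 0 < k := by
    have : (0 : ℝ) < k := by linarith
    exact_mod_cast this
  have hR1 : 8 * k * (n / (8 * k)) ≤ n := Nat.mul_div_le n (8 * k)
  have hR2 : n < 8 * k * (n / (8 * k)) + 8 * k := Nat.lt_mul_div_succ n (by omega)
  -- `512 * k ≤ 1 / x ≤ n`, by `hεn`. So `R ≥ 64`, and terms linear in `R` are negligible.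
  have hnk : 8 * k * 64 ≤ n := by
    have : (8 * k * 64 : ℝ) ≤ n := by nlinarith
    exact_mod_cast this
  have hR3 : 64 ≤ n / (8 * k) := (Nat.le_div_iff_mul_le (by omega)).2 (by linarith)
  generalize n / (8 * k) = R at hR1 hR2 hR3
  obtain ⟨Z, hZ⟩ : ∃ Z, n = 8 * k * R + Z := ⟨n - 8 * k * R, by omega⟩
  have hZ8 : Z ≤ 8 * k := by omega
  have e : Fin n ≃ CorrClust.Vtx k 2 R (k * (2 * R)) Z := Fintype.equivOfCardEq (by
    simp only [Fintype.card_fin, Fintype.card_sum, Fintype.card_prod]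
    rw [hZ]
    ring)
  by_contra hcon
  rw [not_le] at hcon
  have hk' : (0 : ℝ) < k := by linarith
  have hR' : (64 : ℝ) ≤ R := by exact_mod_cast hR3
  have hZ' : (Z : ℝ) ≤ 8 * k := by exact_mod_cast hZ8
  have hn16 : (n : ℝ) ≤ 16 * (k * R) := by
    have : n ≤ 16 * (k * R) := by nlinarith
    exact_mod_cast this
  have hδ : x * (n : ℝ) ^ 2 ≤ k * R ^ 2 / 2 := by
    have h1 : (n : ℝ) ^ 2 ≤ (16 * (k * R)) ^ 2 := by gcongr
    have h2 : x * (n : ℝ) ^ 2 ≤ x * (16 * (k * R)) ^ 2 := by gcongr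
    have h3 : 512 * x * k * (k * R ^ 2 / 2) ≤ 1 * (k * R ^ 2 / 2) := by gcongr
    linarith
  have hkR : 64 * (k * R : ℝ) ≤ k * R ^ 2 := by
    have : (0 : ℝ) ≤ k * R := by positivity
    nlinarith
  have hk64 : 64 * (k : ℝ) ≤ k * R := by nlinarith
  have hR2k : 1900 * (R : ℝ) ^ 2 ≤ k * R ^ 2 := by gcongr
  -- The constant `1 / 10 ^ 7` enters here: `64 * 16 * 1024 / 10 ^ 7 < 1 / 8`.
  have hqb : 32 * (2 * R) * (1 / 10 ^ 7 * (n / x)) / k ≤ k * (R : ℝ) ^ 2 * (1 / 8) := by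
    have h1 : (n : ℝ) / x ≤ 16 * (k * R) * (1024 * k) := by
      rw [div_le_iff₀ hx0]
      have : 16 * (k * R : ℝ) * 1 ≤ 16 * (k * R) * (1024 * x * k) := by gcongr
      linarith
    rw [div_le_iff₀ hk']
    have h2 : 32 * (2 * R) * (1 / 10 ^ 7 * (n / x))
        ≤ 32 * (2 * R) * (1 / 10 ^ 7 * (16 * (k * R) * (1024 * k)) : ℝ) := by gcongr
    refine h2.trans ?_
    have : (0 : ℝ) ≤ k ^ 2 * R ^ 2 := by positivity
    linarith
  -- In units of `k * R ^ 2`, the gap in `hpos` is above `2.8`, and the left side of `hnum` is below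
  -- `0.3`.
  refine CorrClust.not_solves (q := 1 / 10 ^ 7 * (n / x)) e hk0 (by linarith) ?_ ?_ A ?_ hA
  · nlinarith
  · nlinarith
  · intro T hT G L
    have h1 : (T.numQueries G L : ℕ∞) ≤ A.worstCaseQueries := by
      refine le_trans ?_ (le_iSup₂ (f := fun (T : CorrClust.QueryAlg n) (_ : T ∈ A.support) =>
        ⨆ G : SimpleGraph (Fin n), ⨆ L : CorrClust.NbrOrder G, (T.numQueries G L : ℕ∞)) T hT)
      exact le_iSup₂ (f := fun (G : SimpleGraph (Fin n)) (L : CorrClust.NbrOrder G) =>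
        (T.numQueries G L : ℕ∞)) G L
    have h2 : ((T.numQueries G L : ℕ) : ℝ≥0∞) ≤ (A.worstCaseQueries : ℝ≥0∞) := by
      exact_mod_cast ENat.toENNReal_le.2 h1
    have h3 := h2.trans hcon.le
    rw [← ENNReal.ofReal_natCast, ENNReal.ofReal_le_ofReal_iff (by positivity)] at h3
    exact h3
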